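/- For $\rho\in(-1,1)\setminus\{0\}$ and $\gamma\in\mathbb R$ let $F_{\rho,\gamma}$ be the distribution function of $$\rho\left[\left(Z_1+\frac{\gamma}{\sqrt{2(1-\rho)}}\right)^2-\left(Z_2+\frac{\gamma}{\sqrt{2(1+\rho)}}\right)^2\right],$$ where $Z_1,Z_2$ are independent standard normal variables (the weak-strong asymptotic laws), and for $\delta\in\mathbb R$ let $G_\delta$ be the distribution function of $\mathcal N(\delta^2,(2\delta)^2)$, read as the point mass at $0$ if $\delta=0$ (the weak-weak asymptotic laws). The envelope of a family $\{F_h:h\in\mathcal H\}$ of distribution functions on $\mathbb R$ is the function $\bar F$ with $\bar F(x)=\bar F^*(x)$ if $\bar F^*:=\sup_{h\in\mathcal H}F_h$ is continuous at $x$, and $\bar F(x)=\lim_{y\to x^+}\bar F^*(y)$ otherwise. Let $\bar F_\rho$ be the envelope of $\{F_{\rho,\gamma}:\gamma\in\mathbb R\}$ and $\bar G$ the envelope of $\{G_\delta:\delta\in\mathbb R\}$. Then $\bar F_\rho$ $(0<|\rho|<1)$ and $\bar G$ are distribution functions of probability measures on $\mathbb R$; $\bar G$ is the distribution function of the equal-probability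 mixture of $-\chi^2_1$ (the law of $-Z^2$ with $Z$ standard normal) and the point mass at $0$; and $\bar F_\rho$ converges weakly to $\bar G$ as $\rho\to0$. Hence the family extended by $\bar F_0:=\bar G$ is continuous at $\rho=0$ in the topology of weak convergence. -/

import Mathlib

open MeasureTheory ProbabilityTheory Filter Topology

noncomputable section

/-- The pointwise supremum `F*(x) = sup_h F_h(x)` of a family of functions on the real line. -/
def pointwiseSup {ι : Type*} (F : ι → ℝ → ℝ) (x : ℝ) : ℝ := ⨆ h, F h x

open Classical in
/-- The envelope of a family of distribution functions: the pointwise supremum where the latter is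
continuous, and the right limit of the pointwise supremum where it is not. -/
def envelope {ι : Type*} (F : ι → ℝ → ℝ) (x : ℝ) : ℝ :=
  if ContinuousAt (pointwiseSup F) x then pointwiseSup F x
  else Function.rightLim (pointwiseSup F) x

/-- The weak-strong asymptotic law with parameters `ρ` and `γ`: the law of
`ρ * ((Z₁ + γ / √(2 (1 - ρ)))² - (Z₂ + γ / √(2 (1 + ρ)))²)`
for independent standard normal variables `Z₁`, `Z₂`. -/
def weakStrongLaw (ρ γ : ℝ) : Measure ℝ :=
  ((gaussianReal 0 1).prod (gaussianReal 0 1)).map fun z : ℝ × ℝ =>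
    ρ * ((z.1 + γ / √(2 * (1 - ρ))) ^ 2 - (z.2 + γ / √(2 * (1 + ρ))) ^ 2)

instance (ρ γ : ℝ) : IsProbabilityMeasure (weakStrongLaw ρ γ) :=
  Measure.isProbabilityMeasure_map (Measurable.aemeasurable (by fun_prop))

/-- The weak-weak asymptotic law with parameter `δ`: the normal law with mean `δ²` and variance
`(2 δ)²` (the point mass at `0` if `δ = 0`). -/
def weakWeakLaw (δ : ℝ) : Measure ℝ :=
  gaussianReal (δ ^ 2) (Real.toNNReal ((2 * δ) ^ 2))

instance (δ : ℝ) : IsProbabilityMeasure (weakWeakLaw δ) :=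
  inferInstanceAs (IsProbabilityMeasure (gaussianReal _ _))

/-- The weak-strong envelope: the envelope over the local parameter `γ`, for fixed `ρ`. -/
def weakStrongEnvelope (ρ : ℝ) : ℝ → ℝ :=
  envelope fun (γ : ℝ) (x : ℝ) => cdf (weakStrongLaw ρ γ) x

/-- The weak-weak envelope: the envelope over the local parameter `δ`. -/
def weakWeakEnvelope : ℝ → ℝ :=
  envelope fun (δ : ℝ) (x : ℝ) => cdf (weakWeakLaw δ) x

/-- The chi-square law with one degree of freedom: the law of `Z²` for a standard normal `Z`. -/
def chiSquareOne : Measure ℝ := (gaussianReal 0 1).map fun z => z ^ 2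

instance : IsProbabilityMeasure chiSquareOne :=
  Measure.isProbabilityMeasure_map (Measurable.aemeasurable (by fun_prop))

/-- The equal-probability mixture of the law of the negative of a chi-square variable with one
degree of freedom and the point mass at `0`. -/
def negChiSquareMixture : Measure ℝ :=
  (2⁻¹ : ENNReal) • (chiSquareOne.map fun y => -y) + (2⁻¹ : ENNReal) • Measure.dirac 0

end

/-!
Rotating the pair of standard normals shows that, for `δ = ρ γ / √(1 - ρ²)`, the weak-strong
variable is the weak-weak variable `δ² + 2 δ Z` plus the remainder `ρ (Z₁² - Z₂²)`, which does not
involve `γ`. Hence the distribution functions of the two laws are close in the sense of Lévy,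
uniformly in `γ`; as `γ ↦ δ` is onto, this closeness passes to the suprema and to the envelopes, and
it improves to equality in the limit `ρ → 0`. For `x < 0`, the weak-weak distribution function
`Φ ((x - δ²) / (2 |δ|))` is largest at `|δ| = √(-x)`, by the inequality of arithmetic and geometric
means; the resulting supremum `Φ (-√(-x))` is the distribution function of the mixture.
-/

open Set

namespace WeakIdentification

/-! ### Distribution functions -/

lemma measureReal_Ioc_eq_cdf_sub (μ : Measure ℝ) [IsProbabilityMeasure μ] {a b : ℝ}
    (hab : a ≤ b) : μ.real (Ioc a b) = cdf μ b - cdf μ a := by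
  rw [cdf_eq_real, cdf_eq_real, ← Iic_sdiff_Iic,
    measureReal_sdiff (Iic_subset_Iic.2 hab) measurableSet_Iic]

lemma exists_continuousAt_mem_Ioo {f : ℝ → ℝ} (hf : Monotone f) {a b : ℝ} (hab : a < b) :
    ∃ c ∈ Ioo a b, ContinuousAt f c := by
  obtain ⟨c, hc, hmem⟩ := (hf.countable_not_continuousAt.dense_compl ℝ).exists_mem_open isOpen_Ioo
    (nonempty_Ioo.2 hab)
  exact ⟨c, hmem, not_not.1 hc⟩

theorem tendsto_probabilityMeasure_of_tendsto_cdf {ι : Type*} {l : Filter ι}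
    [l.IsCountablyGenerated] {μ : ι → ProbabilityMeasure ℝ} {ν : ProbabilityMeasure ℝ}
    (h : ∀ x, ContinuousAt (cdf (ν : Measure ℝ)) x →
      Tendsto (fun i => cdf (μ i : Measure ℝ) x) l (𝓝 (cdf (ν : Measure ℝ) x))) :
    Tendsto μ l (𝓝 ν) := by
  have hmono : Monotone (cdf (ν : Measure ℝ)) := monotone_cdf _
  refine IsPiSystem.tendsto_probabilityMeasure_of_tendsto_of_mem
    (S := {s | ∃ a b, a < b ∧ ContinuousAt (cdf (ν : Measure ℝ)) a ∧
      ContinuousAt (cdf (ν : Measure ℝ)) b ∧ s = Ioc a b}) ?piSystem ?measurable ?basis ?limit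
  case piSystem =>
    rintro _ ⟨a, b, -, ha, hb, rfl⟩ _ ⟨c, d, -, hc, hd, rfl⟩ hne
    rw [Ioc_inter_Ioc] at hne ⊢
    refine ⟨_, _, nonempty_Ioc.1 hne, ?_, ?_, rfl⟩
    · rcases max_choice a c with h | h <;> rw [h] <;> assumption
    · rcases min_choice b d with h | h <;> rw [h] <;> assumption
  case measurable =>
    rintro _ ⟨a, b, -, -, -, rfl⟩
    exact measurableSet_Ioc
  case basis =>
    intro u hu x hx
    obtain ⟨p, q, hpq, hsub⟩ := mem_nhds_iff_exists_Ioo_subset.1 (hu.mem_nhds hx)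
    obtain ⟨a, ha, hac⟩ := exists_continuousAt_mem_Ioo hmono hpq.1
    obtain ⟨b, hb, hbc⟩ := exists_continuousAt_mem_Ioo hmono hpq.2
    exact ⟨Ioc a b, ⟨a, b, ha.2.trans hb.1, hac, hbc, rfl⟩, Ioc_mem_nhds ha.2 hb.1,
      fun y hy => hsub ⟨ha.1.trans hy.1, hy.2.trans_lt hb.2⟩⟩
  case limit =>
    rintro _ ⟨a, b, hab, ha, hb, rfl⟩
    have hIoc (m : ProbabilityMeasure ℝ) :
        ((m (Ioc a b) : NNReal) : ℝ) = cdf (m : Measure ℝ) b - cdf (m : Measure ℝ) a :=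
      measureReal_Ioc_eq_cdf_sub (m : Measure ℝ) hab.le
    simpa only [← NNReal.tendsto_coe, hIoc] using (h b hb).sub (h a ha)

lemma tendsto_measureReal_lt_abs_atTop {Ω : Type*} [MeasurableSpace Ω] (m : Measure Ω)
    [IsFiniteMeasure m] {X : Ω → ℝ} (hX : Measurable X) :
    Tendsto (fun t => m.real {ω | t < |X ω|}) atTop (𝓝 0) := by
  have htight := tendsto_measure_norm_gt_of_isTightMeasureSet
    (isTightMeasureSet_singleton (μ := m.map X))
  have hmap (t : ℝ) : m.map X {x | t < ‖x‖} = m {ω | t < |X ω|} :=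
    Measure.map_apply hX (measurableSet_lt measurable_const measurable_norm)
  simp only [mem_singleton_iff, iSup_iSup_eq_left, hmap] at htight
  exact (ENNReal.tendsto_toReal ENNReal.zero_ne_top).comp htight

/-! ### Closeness of distribution functions -/

/-- Closeness of two functions on the line up to a horizontal shift `ε` and a vertical error `t`;
two distribution functions are at Lévy distance at most `ε` when this holds with `t = ε`. -/
def LevyClose (ε t : ℝ) (F G : ℝ → ℝ) : Prop :=
  ∀ x, F x ≤ G (x + ε) + t ∧ G x ≤ F (x + ε) + t

lemma cdf_map_le_cdf_map_add {Ω : Type*} [MeasurableSpace Ω] (m : Measure Ω)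
    [IsProbabilityMeasure m] {X Y : Ω → ℝ} (hX : Measurable X) (hY : Measurable Y) (x ε : ℝ) :
    cdf (m.map X) x ≤ cdf (m.map Y) (x + ε) + m.real {ω | ε < |X ω - Y ω|} := by
  have := Measure.isProbabilityMeasure_map (μ := m) hX.aemeasurable
  have := Measure.isProbabilityMeasure_map (μ := m) hY.aemeasurable
  rw [cdf_eq_real, cdf_eq_real, map_measureReal_apply hX measurableSet_Iic,
    map_measureReal_apply hY measurableSet_Iic]
  refine (measureReal_mono fun ω hω => ?_).trans (measureReal_union_le _ _)
  simp only [mem_preimage, mem_Iic, mem_union, mem_ofPred_eq] at hω ⊢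
  by_contra! hfar
  linarith [neg_abs_le (X ω - Y ω)]

theorem levyClose_cdf_map_add {Ω : Type*} [MeasurableSpace Ω] (m : Measure Ω)
    [IsProbabilityMeasure m] {R Y : Ω → ℝ} (hR : Measurable R) (hY : Measurable Y) (ε : ℝ) :
    LevyClose ε (m.real {ω | ε < |R ω|}) (cdf (m.map fun ω => R ω + Y ω)) (cdf (m.map Y)) := by
  have hRY : Measurable fun ω => R ω + Y ω := hR.add hY
  refine fun x => ⟨?_, ?_⟩
  · simpa only [add_sub_cancel_right] using cdf_map_le_cdf_map_add m hRY hY x ε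
  · simpa only [sub_add_cancel_right, abs_neg] using cdf_map_le_cdf_map_add m hY hRY x ε

namespace LevyClose

variable {ε t : ℝ} {F G : ℝ → ℝ}

protected lemma symm (h : LevyClose ε t F G) : LevyClose ε t G F := fun x => (h x).symm

lemma pointwiseSup_le {ι κ : Type*} [Nonempty ι] {F : ι → ℝ → ℝ} {G : κ → ℝ → ℝ} {e : ι → κ}
    (hG : ∀ x, BddAbove (range fun k => G k x)) (h : ∀ i, LevyClose ε t (F i) (G (e i))) (x : ℝ) :
    pointwiseSup F x ≤ pointwiseSup G (x + ε) + t :=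
  ciSup_le fun i => (h i x).1.trans <| by
    gcongr
    exact le_ciSup (hG (x + ε)) (e i)

protected theorem pointwiseSup {ι κ : Type*} [Nonempty ι] {F : ι → ℝ → ℝ} {G : κ → ℝ → ℝ}
    {e : ι → κ} (he : e.Surjective) (hF : ∀ x, BddAbove (range fun i => F i x))
    (hG : ∀ x, BddAbove (range fun k => G k x)) (h : ∀ i, LevyClose ε t (F i) (G (e i))) :
    LevyClose ε t (pointwiseSup F) (pointwiseSup G) := by
  have : Nonempty κ := ‹Nonempty ι›.map e
  refine fun x => ⟨pointwiseSup_le hG h x,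
    pointwiseSup_le (e := Function.surjInv he) hF (fun k => ?_) x⟩
  simpa only [Function.surjInv_eq he k] using (h (Function.surjInv he k)).symm

lemma rightLim_le (hF : Monotone F) (hG : Monotone G) (h : LevyClose ε t F G) (x : ℝ) :
    Function.rightLim F x ≤ Function.rightLim G (x + ε) + t := by
  have hshift : Tendsto (· + ε) (𝓝[>] x) (𝓝[>] (x + ε)) :=
    tendsto_nhdsWithin_iff.2 ⟨((continuous_add_const ε).tendsto x).mono_left nhdsWithin_le_nhds,
      eventually_nhdsWithin_of_forall fun y hy => add_lt_add_left hy ε⟩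
  exact le_of_tendsto_of_tendsto' (hF.tendsto_rightLim x)
    (((hG.tendsto_rightLim (x + ε)).comp hshift).add_const t) fun y => (h y).1

protected theorem rightLim (hF : Monotone F) (hG : Monotone G) (h : LevyClose ε t F G) :
    LevyClose ε t (Function.rightLim F) (Function.rightLim G) :=
  fun x => ⟨h.rightLim_le hF hG x, h.symm.rightLim_le hG hF x⟩

theorem tendsto_atBot_zero {t : ℝ → ℝ} (h : ∀ ε, LevyClose ε (t ε) F G) (hF : ∀ x, 0 ≤ F x)
    (hG : Tendsto G atBot (𝓝 0)) (ht : Tendsto t atTop (𝓝 0)) : Tendsto F atBot (𝓝 0) := by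
  have hbound : Tendsto (fun x : ℝ => G (x / 2) + t (-x / 2)) atBot (𝓝 0) := by
    simpa only [add_zero, Function.comp_def, id] using
      (hG.comp (tendsto_id.atBot_div_const zero_lt_two)).add
        (ht.comp (tendsto_neg_atBot_atTop.atTop_div_const zero_lt_two))
  refine squeeze_zero hF (fun x => ?_) hbound
  convert (h (-x / 2) x).1 using 3
  ring

theorem tendsto_of_continuousAt {α : Type*} {l : Filter α} {F : α → ℝ → ℝ} {t : ℝ → α → ℝ}
    (h : ∀ ε > 0, ∀ᶠ i in l, LevyClose ε (t ε i) (F i) G)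
    (ht : ∀ ε > 0, Tendsto (t ε) l (𝓝 0)) {x : ℝ} (hx : ContinuousAt G x) :
    Tendsto (fun i => F i x) l (𝓝 (G x)) := by
  refine tendsto_order.2 ⟨fun a ha => ?_, fun a ha => ?_⟩
  · have hleft : Tendsto (fun ε => G (x - ε)) (𝓝[>] 0) (𝓝 (G x)) :=
      hx.tendsto.comp (((continuous_sub_left x).tendsto' 0 x (sub_zero x)).mono_left
        nhdsWithin_le_nhds)
    obtain ⟨ε, hε, hpos⟩ := ((hleft.eventually_const_lt ha).and self_mem_nhdsWithin).exists
    filter_upwards [h ε hpos, (ht ε hpos).eventually_lt_const (sub_pos.2 hε)] with i hi hti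
    have hle := (hi (x - ε)).2
    rw [sub_add_cancel] at hle
    linarith
  · have hright : Tendsto (fun ε => G (x + ε)) (𝓝[>] 0) (𝓝 (G x)) :=
      hx.tendsto.comp (((continuous_const_add x).tendsto' 0 x (add_zero x)).mono_left
        nhdsWithin_le_nhds)
    obtain ⟨ε, hε, hpos⟩ := ((hright.eventually_lt_const ha).and self_mem_nhdsWithin).exists
    filter_upwards [h ε hpos, (ht ε hpos).eventually_lt_const (sub_pos.2 hε)] with i hi hti
    linarith [(hi x).1]

end LevyClose

/-! ### Envelopes -/

theorem envelope_eq_rightLim {ι : Type*} (F : ι → ℝ → ℝ) :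
    envelope F = Function.rightLim (pointwiseSup F) := by
  ext x
  unfold envelope
  split_ifs with hcont
  · exact hcont.continuousWithinAt.rightLim_eq.symm
  · rfl

section CdfFamily

variable {ι : Type*} (μ : ι → Measure ℝ)

lemma bddAbove_range_cdf (x : ℝ) : BddAbove (range fun i => cdf (μ i) x) :=
  ⟨1, forall_mem_range.2 fun i => cdf_le_one (μ i) x⟩

lemma cdf_le_pointwiseSup (i : ι) (x : ℝ) : cdf (μ i) x ≤ pointwiseSup (fun i => cdf (μ i)) x :=
  le_ciSup (bddAbove_range_cdf μ x) i

lemma pointwiseSup_cdf_nonneg (x : ℝ) : 0 ≤ pointwiseSup (fun i => cdf (μ i)) x :=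
  Real.iSup_nonneg fun i => cdf_nonneg (μ i) x

lemma pointwiseSup_cdf_le_one (x : ℝ) : pointwiseSup (fun i => cdf (μ i)) x ≤ 1 :=
  Real.iSup_le (fun i => cdf_le_one (μ i) x) zero_le_one

lemma monotone_pointwiseSup_cdf : Monotone (pointwiseSup fun i => cdf (μ i)) := fun _ y hxy =>
  Real.iSup_le (fun i => (monotone_cdf (μ i) hxy).trans (cdf_le_pointwiseSup μ i y))
    (pointwiseSup_cdf_nonneg μ y)

lemma tendsto_pointwiseSup_cdf_atTop [Nonempty ι] :
    Tendsto (pointwiseSup fun i => cdf (μ i)) atTop (𝓝 1) :=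
  have i : ι := Classical.arbitrary ι
  tendsto_of_tendsto_of_tendsto_of_le_of_le (tendsto_cdf_atTop (μ i)) tendsto_const_nhds
    (cdf_le_pointwiseSup μ i) (pointwiseSup_cdf_le_one μ)

theorem exists_cdf_eq_envelope [Nonempty ι]
    (h : Tendsto (pointwiseSup fun i => cdf (μ i)) atBot (𝓝 0)) :
    ∃ P : ProbabilityMeasure ℝ, ⇑(cdf (P : Measure ℝ)) = envelope fun i => cdf (μ i) := by
  let f : StieltjesFunction ℝ := (monotone_pointwiseSup_cdf μ).stieltjesFunction
  have hbot : Tendsto f atBot (𝓝 0) := tendsto_rightLim_atBot_of_tendsto h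
  have htop : Tendsto f atTop (𝓝 1) :=
    tendsto_rightLim_atTop_of_tendsto (tendsto_pointwiseSup_cdf_atTop μ)
  refine ⟨⟨f.measure, f.isProbabilityMeasure hbot htop⟩, ?_⟩
  rw [envelope_eq_rightLim, ProbabilityMeasure.coe_mk, cdf_measure_stieltjesFunction f hbot htop]
  rfl

end CdfFamily

/-! ### Normal laws -/

theorem cdf_gaussianReal (m : ℝ) {v : NNReal} (hv : v ≠ 0) (x : ℝ) :
    cdf (gaussianReal m v) x = cdf (gaussianReal 0 1) ((x - m) / √v) := by
  have hsqrt : 0 < √(v : ℝ) := Real.sqrt_pos.2 (by positivity)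
  have hstd : (gaussianReal m v).map (fun z => (z - m) / √v) = gaussianReal 0 1 := by
    have hcomp : (fun z => (z - m) / √(v : ℝ)) = (· / √(v : ℝ)) ∘ (· - m) := rfl
    rw [hcomp, ← Measure.map_map (by fun_prop) (by fun_prop), gaussianReal_map_sub_const,
      gaussianReal_map_div_const, sub_self, zero_div]
    congr 1
    ext
    simp [hv]
  rw [cdf_eq_real, cdf_eq_real, ← hstd, map_measureReal_apply (by fun_prop) measurableSet_Iic]
  congr 1
  ext z
  simp [div_le_div_iff_of_pos_right hsqrt]

lemma measureReal_gaussianReal_zero_Ici (v : NNReal) (s : ℝ) :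
    (gaussianReal 0 v).real (Ici s) = cdf (gaussianReal 0 v) (-s) := by
  have hneg : (gaussianReal 0 v).map (fun z => -z) = gaussianReal 0 v := by
    rw [gaussianReal_map_neg, neg_zero]
  conv_lhs => rw [← hneg]
  rw [cdf_eq_real, map_measureReal_apply (by fun_prop) measurableSet_Ici]
  simp

theorem map_mul_add_mul_gaussianReal_prod (m₁ m₂ : ℝ) (v₁ v₂ : NNReal) (a b : ℝ) :
    ((gaussianReal m₁ v₁).prod (gaussianReal m₂ v₂)).map (fun z => a * z.1 + b * z.2) =
      gaussianReal (a * m₁ + b * m₂)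
        (.mk (a ^ 2) (sq_nonneg a) * v₁ + .mk (b ^ 2) (sq_nonneg b) * v₂) := by
  rw [← gaussianReal_conv_gaussianReal, ← gaussianReal_map_const_mul, ← gaussianReal_map_const_mul,
    Measure.conv, Measure.map_prod_map _ _ (by fun_prop) (by fun_prop),
    Measure.map_map (by fun_prop) (by fun_prop)]
  rfl

/-! ### The weak-weak envelope -/

lemma cdf_weakWeakLaw_of_ne_zero {δ : ℝ} (hδ : δ ≠ 0) (x : ℝ) :
    cdf (weakWeakLaw δ) x = cdf (gaussianReal 0 1) ((x - δ ^ 2) / (2 * |δ|)) := by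
  have hv : Real.toNNReal ((2 * δ) ^ 2) ≠ 0 := (Real.toNNReal_pos.2 (by positivity)).ne'
  rw [weakWeakLaw, cdf_gaussianReal _ hv, Real.coe_toNNReal _ (sq_nonneg _), Real.sqrt_sq_eq_abs,
    abs_mul, abs_two]

lemma cdf_weakWeakLaw_zero (x : ℝ) :
    cdf (weakWeakLaw 0) x = (Measure.dirac (0 : ℝ)).real (Iic x) := by
  simp [weakWeakLaw, cdf_eq_real]

lemma sub_sq_div_two_mul_abs_le {x δ : ℝ} (hx : x ≤ 0) (hδ : δ ≠ 0) :
    (x - δ ^ 2) / (2 * |δ|) ≤ -√(-x) := by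
  rw [div_le_iff₀ (by positivity)]
  nlinarith [sq_nonneg (√(-x) - |δ|), Real.sq_sqrt (neg_nonneg.2 hx), sq_abs δ]

theorem pointwiseSup_weakWeakLaw_of_nonneg {x : ℝ} (hx : 0 ≤ x) :
    pointwiseSup (fun δ => cdf (weakWeakLaw δ)) x = 1 := by
  refine le_antisymm (pointwiseSup_cdf_le_one _ x) ?_
  refine le_of_eq_of_le ?_ (cdf_le_pointwiseSup weakWeakLaw 0 x)
  simp [cdf_weakWeakLaw_zero, measureReal_def, hx]

theorem pointwiseSup_weakWeakLaw_of_neg {x : ℝ} (hx : x < 0) :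
    pointwiseSup (fun δ => cdf (weakWeakLaw δ)) x = cdf (gaussianReal 0 1) (-√(-x)) := by
  refine le_antisymm (ciSup_le fun δ => ?_) ?_
  · rcases eq_or_ne δ 0 with rfl | hδ
    · simpa [cdf_weakWeakLaw_zero, measureReal_def, hx.not_ge] using cdf_nonneg _ _
    · exact (cdf_weakWeakLaw_of_ne_zero hδ x).trans_le
        (monotone_cdf _ (sub_sq_div_two_mul_abs_le hx.le hδ))
  · have hs : 0 < √(-x) := Real.sqrt_pos.2 (neg_pos.2 hx)
    have hmax : (x - √(-x) ^ 2) / (2 * |√(-x)|) = -√(-x) := by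
      rw [abs_of_pos hs, div_eq_iff (by positivity)]
      linear_combination Real.sq_sqrt (neg_nonneg.2 hx.le)
    rw [← hmax, ← cdf_weakWeakLaw_of_ne_zero hs.ne']
    exact cdf_le_pointwiseSup weakWeakLaw _ x

instance : IsProbabilityMeasure negChiSquareMixture := by
  have : IsProbabilityMeasure (chiSquareOne.map fun y => -y) :=
    Measure.isProbabilityMeasure_map (by fun_prop)
  constructor
  simp [negChiSquareMixture, ENNReal.inv_two_add_inv_two]

lemma cdf_negChiSquareMixture (x : ℝ) :
    cdf negChiSquareMixture x = 2⁻¹ * (gaussianReal 0 1).real {z | -z ^ 2 ≤ x} +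
      2⁻¹ * (Measure.dirac (0 : ℝ)).real (Iic x) := by
  have : IsProbabilityMeasure (chiSquareOne.map fun y => -y) :=
    Measure.isProbabilityMeasure_map (by fun_prop)
  have hneg : (chiSquareOne.map fun y => -y).real (Iic x) =
      (gaussianReal 0 1).real {z | -z ^ 2 ≤ x} := by
    rw [chiSquareOne, Measure.map_map (by fun_prop) (by fun_prop),
      map_measureReal_apply (by fun_prop) measurableSet_Iic]
    rfl
  rw [cdf_eq_real, negChiSquareMixture,
    measureReal_add_apply (ENNReal.mul_ne_top (by simp) (measure_ne_top _ _))
      (ENNReal.mul_ne_top (by simp) (measure_ne_top _ _)),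
    measureReal_ennreal_smul_apply, measureReal_ennreal_smul_apply, hneg]
  simp

lemma measureReal_gaussianReal_neg_sq_le {x : ℝ} (hx : x < 0) (v : NNReal) :
    (gaussianReal 0 v).real {z | -z ^ 2 ≤ x} = 2 * cdf (gaussianReal 0 v) (-√(-x)) := by
  have hs : 0 < √(-x) := Real.sqrt_pos.2 (neg_pos.2 hx)
  have hset : {z : ℝ | -z ^ 2 ≤ x} = Iic (-√(-x)) ∪ Ici √(-x) := by
    ext z
    rw [mem_ofPred_eq, neg_le, ← sq_abs, ← Real.sqrt_le_left (abs_nonneg z), le_abs', mem_union,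
      mem_Iic, mem_Ici]
  have hdisj : Disjoint (Iic (-√(-x))) (Ici √(-x)) := Iic_disjoint_Ici.2 (by linarith)
  rw [hset, measureReal_union hdisj measurableSet_Ici, measureReal_gaussianReal_zero_Ici,
    ← cdf_eq_real, two_mul]

theorem pointwiseSup_weakWeakLaw :
    pointwiseSup (fun δ => cdf (weakWeakLaw δ)) = cdf negChiSquareMixture := by
  ext x
  rw [cdf_negChiSquareMixture]
  rcases le_or_gt 0 x with hx | hx
  · have huniv : {z : ℝ | -z ^ 2 ≤ x} = univ :=
      eq_univ_of_forall fun z => (neg_nonpos.2 (sq_nonneg z)).trans hx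
    have hdirac : (Measure.dirac (0 : ℝ)).real (Iic x) = 1 := by simp [measureReal_def, hx]
    rw [pointwiseSup_weakWeakLaw_of_nonneg hx, huniv, probReal_univ, hdirac]
    norm_num
  · rw [pointwiseSup_weakWeakLaw_of_neg hx, measureReal_gaussianReal_neg_sq_le hx]
    simp [measureReal_def, hx.not_ge]

theorem weakWeakEnvelope_eq_cdf : weakWeakEnvelope = cdf negChiSquareMixture := by
  rw [weakWeakEnvelope, envelope_eq_rightLim, pointwiseSup_weakWeakLaw]
  exact funext (StieltjesFunction.rightLim_eq _)

/-! ### The weak-strong envelope -/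

/-- The law of a pair of independent standard normal variables. -/
noncomputable abbrev stdGaussianPair : Measure (ℝ × ℝ) := (gaussianReal 0 1).prod (gaussianReal 0 1)

/-- The probability that `|Z₁² - Z₂²|` exceeds `t`, for independent standard normal variables
`Z₁`, `Z₂`; it controls the distance between the weak-strong and the weak-weak laws. -/
noncomputable def squareDiffTail (t : ℝ) : ℝ := stdGaussianPair.real {z | t < |z.1 ^ 2 - z.2 ^ 2|}

lemma tendsto_squareDiffTail_atTop : Tendsto squareDiffTail atTop (𝓝 0) :=
  tendsto_measureReal_lt_abs_atTop stdGaussianPair (by fun_prop)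

lemma tendsto_squareDiffTail_div_abs {ε : ℝ} (hε : 0 < ε) :
    Tendsto (fun ρ : ℝ => squareDiffTail (ε / |ρ|)) (𝓝[≠] 0) (𝓝 0) :=
  tendsto_squareDiffTail_atTop.comp
    ((tendsto_inv_nhdsGT_zero.comp tendsto_abs_nhdsNE_zero).const_mul_atTop hε)

lemma weakWeakLaw_eq_map {a b : ℝ} (hab : a ^ 2 + b ^ 2 = 1) (δ : ℝ) :
    weakWeakLaw δ = stdGaussianPair.map fun z => δ ^ 2 + 2 * δ * (a * z.1 - b * z.2) := by
  have hcomp : (fun z : ℝ × ℝ => δ ^ 2 + 2 * δ * (a * z.1 - b * z.2)) =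
      (δ ^ 2 + ·) ∘ fun z => 2 * δ * a * z.1 + -(2 * δ * b) * z.2 := by
    ext z
    simp only [Function.comp_apply]
    ring
  rw [hcomp, ← Measure.map_map (by fun_prop) (by fun_prop), map_mul_add_mul_gaussianReal_prod,
    gaussianReal_map_const_add, weakWeakLaw]
  congr 1
  · ring
  · ext
    rw [Real.coe_toNNReal _ (sq_nonneg _)]
    simp only [NNReal.coe_add, NNReal.coe_mul, NNReal.coe_mk, NNReal.coe_one]
    linear_combination -4 * δ ^ 2 * hab

lemma sq_sub_sq_mul_shifted_sq_sub_sq {a b : ℝ} (ha : a ≠ 0) (hb : b ≠ 0) (γ x y : ℝ) :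
    (a ^ 2 - b ^ 2) * ((x + γ / (2 * b)) ^ 2 - (y + γ / (2 * a)) ^ 2) =
      (a ^ 2 - b ^ 2) * (x ^ 2 - y ^ 2) +
        (((a ^ 2 - b ^ 2) / (2 * a * b) * γ) ^ 2 +
          2 * ((a ^ 2 - b ^ 2) / (2 * a * b) * γ) * (a * x - b * y)) := by
  field_simp
  ring

lemma levyClose_weakStrongLaw_of_sq_add_sq_eq_one {a b : ℝ} (ha : 0 < a) (hb : 0 < b)
    (hne : a ^ 2 - b ^ 2 ≠ 0) (hab : a ^ 2 + b ^ 2 = 1) (γ ε : ℝ) :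
    LevyClose ε (squareDiffTail (ε / |a ^ 2 - b ^ 2|)) (cdf (weakStrongLaw (a ^ 2 - b ^ 2) γ))
      (cdf (weakWeakLaw ((a ^ 2 - b ^ 2) / (2 * a * b) * γ))) := by
  have hsqrt_b : √(2 * (1 - (a ^ 2 - b ^ 2))) = 2 * b := by
    rw [← Real.sqrt_sq (by positivity : 0 ≤ 2 * b)]
    congr 1
    linear_combination -2 * hab
  have hsqrt_a : √(2 * (1 + (a ^ 2 - b ^ 2))) = 2 * a := by
    rw [← Real.sqrt_sq (by positivity : 0 ≤ 2 * a)]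
    congr 1
    linear_combination -2 * hab
  have htail : squareDiffTail (ε / |a ^ 2 - b ^ 2|) =
      stdGaussianPair.real {z | ε < |(a ^ 2 - b ^ 2) * (z.1 ^ 2 - z.2 ^ 2)|} := by
    simp only [squareDiffTail, div_lt_iff₀' (abs_pos.2 hne), abs_mul]
  rw [htail, weakWeakLaw_eq_map hab, weakStrongLaw]
  simp only [hsqrt_a, hsqrt_b, sq_sub_sq_mul_shifted_sq_sub_sq ha.ne' hb.ne']
  exact levyClose_cdf_map_add stdGaussianPair (by fun_prop) (by fun_prop) ε

theorem levyClose_pointwiseSup_weakStrongLaw {ρ : ℝ} (hρ0 : ρ ≠ 0) (hρ1 : |ρ| < 1) (ε : ℝ) :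
    LevyClose ε (squareDiffTail (ε / |ρ|)) (pointwiseSup fun γ => cdf (weakStrongLaw ρ γ))
      (pointwiseSup fun δ => cdf (weakWeakLaw δ)) := by
  obtain ⟨hlt, hgt⟩ := abs_lt.1 hρ1
  obtain ⟨a, b, ha, hb, hab, rfl⟩ :
      ∃ a b : ℝ, 0 < a ∧ 0 < b ∧ a ^ 2 + b ^ 2 = 1 ∧ a ^ 2 - b ^ 2 = ρ := by
    refine ⟨√((1 + ρ) / 2), √((1 - ρ) / 2), Real.sqrt_pos.2 (by linarith),
      Real.sqrt_pos.2 (by linarith), ?_, ?_⟩ <;>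
    · rw [Real.sq_sqrt (by linarith), Real.sq_sqrt (by linarith)]
      ring
  have hslope : (a ^ 2 - b ^ 2) / (2 * a * b) ≠ 0 := div_ne_zero hρ0 (by positivity)
  exact LevyClose.pointwiseSup (mul_left_surjective₀ hslope) (bddAbove_range_cdf _)
    (bddAbove_range_cdf _) fun γ => levyClose_weakStrongLaw_of_sq_add_sq_eq_one ha hb hρ0 hab γ ε

theorem levyClose_weakStrongEnvelope {ρ : ℝ} (hρ0 : ρ ≠ 0) (hρ1 : |ρ| < 1) (ε : ℝ) :
    LevyClose ε (squareDiffTail (ε / |ρ|)) (weakStrongEnvelope ρ) weakWeakEnvelope := by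
  rw [weakStrongEnvelope, weakWeakEnvelope, envelope_eq_rightLim, envelope_eq_rightLim]
  exact (levyClose_pointwiseSup_weakStrongLaw hρ0 hρ1 ε).rightLim (monotone_pointwiseSup_cdf _)
    (monotone_pointwiseSup_cdf _)

theorem exists_cdf_eq_weakStrongEnvelope {ρ : ℝ} (hρ0 : ρ ≠ 0) (hρ1 : |ρ| < 1) :
    ∃ P : ProbabilityMeasure ℝ, ⇑(cdf (P : Measure ℝ)) = weakStrongEnvelope ρ := by
  refine exists_cdf_eq_envelope _ (LevyClose.tendsto_atBot_zero
    (levyClose_pointwiseSup_weakStrongLaw hρ0 hρ1) (pointwiseSup_cdf_nonneg _) ?_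
    (tendsto_squareDiffTail_atTop.comp (tendsto_id.atTop_div_const (abs_pos.2 hρ0))))
  rw [pointwiseSup_weakWeakLaw]
  exact tendsto_cdf_atBot _

lemma eventually_ne_zero_and_abs_lt_one : ∀ᶠ ρ : ℝ in 𝓝[≠] 0, ρ ≠ 0 ∧ |ρ| < 1 :=
  eventually_mem_nhdsWithin.and <| nhdsWithin_le_nhds <|
    (continuous_abs.tendsto' 0 0 abs_zero).eventually_lt_const zero_lt_one

theorem tendsto_weakStrongEnvelope {x : ℝ} (hx : ContinuousAt weakWeakEnvelope x) :
    Tendsto (fun ρ => weakStrongEnvelope ρ x) (𝓝[≠] 0) (𝓝 (weakWeakEnvelope x)) :=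
  LevyClose.tendsto_of_continuousAt
    (fun ε _ => eventually_ne_zero_and_abs_lt_one.mono fun _ hρ =>
      levyClose_weakStrongEnvelope hρ.1 hρ.2 ε)
    (fun _ => tendsto_squareDiffTail_div_abs) hx

end WeakIdentification

open WeakIdentification

theorem mainTheorem4 :
    ∃ (P : ℝ → ProbabilityMeasure ℝ) (Q : ProbabilityMeasure ℝ),
      (∀ ρ : ℝ, 0 < |ρ| → |ρ| < 1 →
        ∀ x : ℝ, cdf (P ρ : Measure ℝ) x = weakStrongEnvelope ρ x) ∧
      (∀ x : ℝ, cdf (Q : Measure ℝ) x = weakWeakEnvelope x) ∧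
      (Q : Measure ℝ) = negChiSquareMixture ∧
      Tendsto P (𝓝[≠] (0 : ℝ)) (𝓝 Q) ∧
      ContinuousAt (Function.update P 0 Q) 0 := by
  let Q : ProbabilityMeasure ℝ := ⟨negChiSquareMixture, inferInstance⟩
  have hQ : ⇑(cdf (Q : Measure ℝ)) = weakWeakEnvelope := weakWeakEnvelope_eq_cdf.symm
  choose! P hP using fun (ρ : ℝ) (h : ρ ≠ 0 ∧ |ρ| < 1) => exists_cdf_eq_weakStrongEnvelope h.1 h.2
  have hlim : Tendsto P (𝓝[≠] (0 : ℝ)) (𝓝 Q) := by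
    refine tendsto_probabilityMeasure_of_tendsto_cdf fun x hx => ?_
    rw [hQ] at hx ⊢
    refine (tendsto_weakStrongEnvelope hx).congr' ?_
    filter_upwards [eventually_ne_zero_and_abs_lt_one] with ρ hρ
    rw [hP ρ hρ]
  exact ⟨P, Q, fun ρ h0 h1 => congrFun (hP ρ ⟨abs_pos.1 h0, h1⟩), congrFun hQ, rfl, hlim,
    continuousAt_update_same.2 hlim⟩
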